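/- Let $X$ be a complex Banach space, $L(X)$ the algebra of bounded linear operators on $X$, $F_0(X)$ and $K(X)$ the ideals of finite rank and of compact operators, $\mathcal{C}_0(X)=L(X)/F_0(X)$ and $\mathcal{C}(X)=L(X)/K(X)$, with natural projections $\pi: L(X)\to \mathcal{C}_0(X)$ and $\Pi: L(X)\to\mathcal{C}(X)$. For an element $a$ of a unital ring $A$ let $comm(a)=\{x\in A: xa=ax\}$ and $comm^2(a)=\{x\in A: xy=yx \text{ for all } y\in comm(a)\}$; the element $a$ is called quasinilpotent if $1-xa$ is invertible for every $x\in comm(a)$. For $T\in L(X)$ and an idempotent $P\in L(X)$, put $X_1=R(P)$, $X_2=N(P)=R(I-P)$, $T_1=(PTP)|_{X_1}$ and $T_2=((I-P)T(I-P))|_{X_2}$. A bounded operator $S$ on a Banach space is Fredholm if its range is closed and its kernel and cokernel are finite-dimensional; $S$ is Riesz if $S-\lambda I$ is Fredholm for every complex $\lambda\neq 0$. The element $\pi(T)$ is generalized Drazin invertible in $\mathcal{C}_0(X)$ if there is an idempotent $P\in L(X)$ such that $\pi(P)\in comm^2(\pi(T))$, $\pi(P)\pi(T)$ is quasinilpotent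 in $\mathcal{C}_0(X)$ and $\pi(T)+\pi(P)$ is invertible in $\mathcal{C}_0(X)$. An idempotent $P\in L(X)$ is associated to $T$ in $\mathcal{C}(X)$ if $\Pi(P)\in comm(\Pi(T))$, $\Pi(P)\Pi(T)$ is quasinilpotent in $\mathcal{C}(X)$ and $\Pi(T)+\Pi(P)$ is invertible in $\mathcal{C}(X)$; $T$ is pseudo B-Fredholm if such an idempotent exists. $T$ is Riesz-Fredholm if $X=M\oplus N$ with closed $T$-invariant subspaces $M,N$ such that $T|_M$ is Riesz and $T|_N$ is Fredholm. **Theorem.** For $T\in L(X)$ the following are equivalent: 1. $\pi(T)$ is generalized Drazin invertible in $\mathcal{C}_0(X)$; 2. $T$ is pseudo B-Fredholm and there exists an idempotent $P\in L(X)$ associated to $T$ in $\mathcal{C}(X)$ such that $\pi(P)\in comm^2(\pi(T))$; 3. there exists an idempotent $P\in L(X)$ such that $\pi(P)\in comm^2(\pi(T))$, $T_1$ is a Riesz operator and $T_2$ is a Fredholm operator. In this case $T=R+F$ with $R\in L(X)$ a Riesz-Fredholm operator and $F\in L(X)$ of finite rank. -/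

import Mathlib

namespace BFredholm

section Rings

variable {A : Type*} [Ring A]

/-- The commutant `comm(a) = {x | x a = a x}`. -/
def commutant (a : A) : Set A := {x | x * a = a * x}

/-- The double commutant `comm²(a) = {x | x y = y x for all y ∈ comm(a)}`. -/
def doubleCommutant (a : A) : Set A := {x | ∀ y ∈ commutant a, x * y = y * x}

/-- Quasinilpotent elements of a unital ring, in the sense of Harte:
`1 - x a` is invertible for every `x` commuting with `a`. -/
def IsQuasinilpotent (a : A) : Prop := ∀ x ∈ commutant a, IsUnit (1 - x * a)

end Rings

section Algebras

variable (X : Type*) [NormedAddCommGroup X] [NormedSpace ℂ X]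

/-- The two-sided ideal `F₀(X)` of finite rank operators in `L(X)`. -/
def finiteRankIdeal : Ideal (X →L[ℂ] X) where
  carrier := {F | FiniteDimensional ℂ F.range}
  zero_mem' := by
    change FiniteDimensional ℂ (LinearMap.range (0 : X →ₗ[ℂ] X))
    rw [LinearMap.range_zero]
    infer_instance
  add_mem' := by
    intro F G hF hG
    have hF' : FiniteDimensional ℂ F.range := hF
    have hG' : FiniteDimensional ℂ G.range := hG
    refine Submodule.finiteDimensional_of_le (S₂ := F.range ⊔ G.range) ?_
    rintro _ ⟨x, rfl⟩
    exact Submodule.add_mem_sup ⟨x, rfl⟩ ⟨x, rfl⟩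
  smul_mem' := by
    intro S F hF
    have hF' : FiniteDimensional ℂ F.range := hF
    refine Submodule.finiteDimensional_of_le (S₂ := F.range.map (S : X →ₗ[ℂ] X)) ?_
    rintro _ ⟨x, rfl⟩
    exact ⟨F x, ⟨x, rfl⟩, rfl⟩

instance : (finiteRankIdeal X).IsTwoSided where
  mul_mem_of_left := by
    intro F S hF
    have hF' : FiniteDimensional ℂ F.range := hF
    refine Submodule.finiteDimensional_of_le (S₂ := F.range) ?_
    rintro _ ⟨x, rfl⟩
    exact ⟨S x, rfl⟩

/-- The two-sided ideal `K(X)` of compact operators in `L(X)`. -/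
def compactIdeal : Ideal (X →L[ℂ] X) where
  carrier := {K | IsCompactOperator K}
  zero_mem' := isCompactOperator_zero
  add_mem' := fun hK hL => hK.add hL
  smul_mem' := fun S _ hK => hK.clm_comp S

instance : (compactIdeal X).IsTwoSided where
  mul_mem_of_left := fun S hK => hK.comp_clm S

/-- The algebra `C₀(X) = L(X) / F₀(X)`. -/
abbrev C0 : Type _ := (X →L[ℂ] X) ⧸ finiteRankIdeal X

/-- The Calkin algebra `C(X) = L(X) / K(X)`. -/
abbrev Calkin : Type _ := (X →L[ℂ] X) ⧸ compactIdeal X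

variable {X}

/-- The natural projection `π : L(X) → C₀(X)`. -/
abbrev toC0 : (X →L[ℂ] X) →+* C0 X := Ideal.Quotient.mk (finiteRankIdeal X)

/-- The natural projection `Π : L(X) → C(X)`. -/
abbrev toCalkin : (X →L[ℂ] X) →+* Calkin X := Ideal.Quotient.mk (compactIdeal X)

end Algebras

section Operators

variable {X : Type*} [NormedAddCommGroup X] [NormedSpace ℂ X]

/-- The idempotent operator `P` is associated to `T` in `C₀(X)`: `π(P) ∈ comm²(π(T))`,
`π(P)π(T)` is quasinilpotent and `π(T) + π(P)` is invertible in `C₀(X)`. -/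
def IsAssociatedC0 (T P : X →L[ℂ] X) : Prop :=
  IsIdempotentElem P ∧ toC0 P ∈ doubleCommutant (toC0 T) ∧
    IsQuasinilpotent (toC0 P * toC0 T) ∧ IsUnit (toC0 T + toC0 P)

/-- `π(T)` is generalized Drazin invertible in `C₀(X)`. -/
def IsGDrazinInvertibleC0 (T : X →L[ℂ] X) : Prop := ∃ P : X →L[ℂ] X, IsAssociatedC0 T P

/-- The idempotent operator `P` is associated to `T` in `C(X)`: `Π(P) ∈ comm(Π(T))`,
`Π(P)Π(T)` is quasinilpotent and `Π(T) + Π(P)` is invertible in `C(X)`. -/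
def IsAssociatedCalkin (T P : X →L[ℂ] X) : Prop :=
  IsIdempotentElem P ∧ toCalkin P ∈ commutant (toCalkin T) ∧
    IsQuasinilpotent (toCalkin P * toCalkin T) ∧ IsUnit (toCalkin T + toCalkin P)

/-- `T` is a pseudo B-Fredholm operator: `Π(T)` is generalized Drazin invertible in `C(X)`. -/
def IsPseudoBFredholm (T : X →L[ℂ] X) : Prop := ∃ P : X →L[ℂ] X, IsAssociatedCalkin T P

/-- `T` is a Riesz operator: `T - λ I` is Fredholm for every nonzero complex `λ`. -/
def IsRiesz (T : X →L[ℂ] X) : Prop :=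
  ∀ c : ℂ, c ≠ 0 → (T - c • ContinuousLinearMap.id ℂ X).IsFredholm

/-- The restriction of `P T P` to an operator on the range of `P`. For an idempotent `P`, the
operator `T₁` on `X₁ = R(P)` is `compression P T`, and the operator `T₂` on
`X₂ = N(P) = R(I - P)` is `compression (1 - P) T`. -/
def compression (P T : X →L[ℂ] X) : P.range →L[ℂ] P.range :=
  (P * T * P).restrict (p := P.range) (q := P.range) fun x _ => ⟨T (P x), rfl⟩

/-- `T` is a Riesz-Fredholm operator: `X` is the direct sum of two closed `T`-invariant subspaces
`M`, `N` with `T|_M` Riesz and `T|_N` Fredholm. -/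
def IsRieszFredholm (T : X →L[ℂ] X) : Prop :=
  ∃ (M N : Submodule ℂ X) (hM : ∀ x ∈ M, T x ∈ M) (hN : ∀ x ∈ N, T x ∈ N),
    IsClosed (M : Set X) ∧ IsClosed (N : Set X) ∧ IsCompl M N ∧
      IsRiesz (T.restrict hM) ∧ (T.restrict hN).IsFredholm

end Operators

end BFredholm

/-!
The point of the proof is that the three conditions agree for each individual idempotent `P` with
`π(P) ∈ comm²(π(T))`, because all of them can be expressed through Fredholm operators.

* By Atkinson's theorem, `S` is Fredholm iff `π(S)` is invertible
  (`isUnit_toC0_iff_isFredholm`), and iff `Π(S)` is invertible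
  (`isUnit_toCalkin_iff_isFredholm`); the second form rests on the fact that `1 - K` is Fredholm
  for compact `K` (`isFredholm_one_sub_of_isCompactOperator`).
* In a complex Banach algebra an element whose spectrum is contained in `{0}` is quasinilpotent in
  the sense of Harte, by the spectral radius formula (`isQuasinilpotent_of_isUnit_sub`). Applied to
  the Calkin algebra, this shows that `Π(S)` is quasinilpotent iff `S - c` is Fredholm for all
  `c ≠ 0`. By Atkinson's theorem the same criterion holds in `C₀(X)`, where the spectral
  radius formula is not available because `F₀(X)` need not be closed
  (`isQuasinilpotent_toC0_iff`).
* If `π(P)` commutes with `π(T)`, then `T` is block diagonal up to a finite rank operator, and an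
  operator of this kind is Fredholm iff its two compressions are (`isFredholm_iff_compression`).
  Applied to `P T - c` and `T + P`, this turns the criteria above into the statement that `T₁` is
  Riesz and `T₂` is Fredholm.

The decomposition `T = R + F` takes for `R` the block diagonal part of `T`.
-/

namespace BFredholm

open ContinuousLinearMap LinearMap Topology Filter

/-! ### Fredholm operators and the quotient by the finite rank operators -/

section Atkinson

variable {E F : Type*} [NormedAddCommGroup E] [NormedSpace ℂ E]
  [NormedAddCommGroup F] [NormedSpace ℂ F]

theorem isFredholm_iff_exists_hasFiniteRange (u : E →L[ℂ] F) :
    u.IsFredholm ↔ ∃ v : F →L[ℂ] E,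
      LinearMap.HasFiniteRange (v ∘L u - ContinuousLinearMap.id ℂ E : E →L[ℂ] E).toLinearMap ∧
      LinearMap.HasFiniteRange (u ∘L v - ContinuousLinearMap.id ℂ F : F →L[ℂ] F).toLinearMap := by
  rw [isFredholm_iff_exists_isQuasiInverse]
  refine exists_congr fun v => and_congr ?_ ?_ <;>
    exact LinearMap.FiniteRangeSetoid.equiv_iff_hasFiniteRange

theorem mem_finiteRankIdeal_iff (S : E →L[ℂ] E) :
    S ∈ finiteRankIdeal E ↔ S.toLinearMap.HasFiniteRange :=
  Submodule.fg_iff_finiteDimensional _ |>.symm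

theorem hasFiniteRange_comp_comp {Y Z : Type*} [NormedAddCommGroup Y] [NormedSpace ℂ Y]
    [NormedAddCommGroup Z] [NormedSpace ℂ Z] (g : F →L[ℂ] Z) {u : E →L[ℂ] F} (f : Y →L[ℂ] E)
    (hu : u.toLinearMap.HasFiniteRange) : (g ∘L u ∘L f : Y →L[ℂ] Z).toLinearMap.HasFiniteRange :=
  (hu.comp_right f.toLinearMap).comp_left g.toLinearMap

theorem toC0_eq_iff (S S' : E →L[ℂ] E) :
    toC0 S = toC0 S' ↔ (S - S' : E →L[ℂ] E).toLinearMap.HasFiniteRange := by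
  rw [Ideal.Quotient.mk_eq_mk_iff_sub_mem, mem_finiteRankIdeal_iff]

/-- Atkinson's theorem modulo finite rank operators: an inverse of `π(S)` is the class of a
quasi-inverse of `S`. -/
theorem isUnit_toC0_iff_isFredholm (S : E →L[ℂ] E) : IsUnit (toC0 S) ↔ S.IsFredholm := by
  rw [isFredholm_iff_exists_hasFiniteRange, isUnit_iff_exists]
  constructor
  · rintro ⟨b, h₁, h₂⟩
    obtain ⟨V, rfl⟩ := Ideal.Quotient.mk_surjective b
    rw [← map_mul, ← map_one toC0, toC0_eq_iff] at h₁ h₂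
    exact ⟨V, h₂, h₁⟩
  · rintro ⟨V, h₁, h₂⟩
    refine ⟨toC0 V, ?_, ?_⟩ <;> rw [← map_mul, ← map_one toC0, toC0_eq_iff]
    exacts [h₂, h₁]

end Atkinson

/-! ### Compressions -/

section CornerRing

variable {A : Type*} [Ring A]

/-- `a` is invertible relative to the idempotent `p`: the element `p a p` is invertible in the
corner ring `p A p`, with inverse `p b p`. -/
def IsCornerUnit (p a : A) : Prop := ∃ b, p * b * p * a * p = p ∧ p * a * p * b * p = p

/-- For an idempotent `p` commuting with `a`, the element `a` is block diagonal with respect to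
`p` and `1 - p`, so it is invertible iff both blocks are. -/
theorem isUnit_iff_isCornerUnit {p a : A} (hp : IsIdempotentElem p) (h : p * a = a * p) :
    IsUnit a ↔ IsCornerUnit p a ∧ IsCornerUnit (1 - p) a := by
  have key : ∀ {q : A}, IsIdempotentElem q → q * a = a * q → IsUnit a → IsCornerUnit q a := by
    rintro q hq hqa ⟨u, rfl⟩
    have hq' : q * q = q := hq
    refine ⟨(u⁻¹ : Aˣ), ?_, ?_⟩
    · rw [mul_assoc _ q, hqa, mul_assoc _ _ q, mul_assoc _ q q, hq', mul_assoc q, ← mul_assoc _ _ q,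
        u.inv_mul, one_mul, hq']
    · rw [hqa, mul_assoc _ q q, hq', ← hqa, mul_assoc q, u.mul_inv, mul_one, hq']
  refine ⟨fun ha => ⟨key hp h ha, key hp.one_sub ?_ ha⟩, ?_⟩
  · rw [sub_mul, mul_sub, h, one_mul, mul_one]
  · rintro ⟨⟨b, hb₁, hb₂⟩, ⟨c, hc₁, hc₂⟩⟩
    have hq : (1 - p) * a = a * (1 - p) := by rw [sub_mul, mul_sub, h, one_mul, mul_one]
    -- For `q` commuting with `a`, a corner inverse `q d q` satisfies `a (q d q) = q = (q d q) a`.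
    have hinv : ∀ {q d : A}, IsIdempotentElem q → q * a = a * q → q * d * q * a * q = q →
        q * a * q * d * q = q → a * (q * d * q) = q ∧ (q * d * q) * a = q := by
      intro q d hq hqa h₁ h₂
      have hq' : q * q = q := hq
      constructor
      · rw [hqa, mul_assoc a q q, hq'] at h₂
        simpa only [mul_assoc] using h₂
      · rw [mul_assoc _ a q, ← hqa, ← mul_assoc, mul_assoc _ q q, hq'] at h₁
        exact h₁
    obtain ⟨h₁, h₂⟩ := hinv hp h hb₁ hb₂
    obtain ⟨h₃, h₄⟩ := hinv hp.one_sub hq hc₁ hc₂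
    refine isUnit_iff_exists.2 ⟨p * b * p + (1 - p) * c * (1 - p), ?_, ?_⟩
    · rw [mul_add, h₁, h₃, add_sub_cancel]
    · rw [add_mul, h₂, h₄, add_sub_cancel]

end CornerRing

section Compression

variable {X : Type*} [NormedAddCommGroup X] [NormedSpace ℂ X]

/-- A quasi-inverse of the compression of `S` to `R(P)`, extended by zero on `N(P)`, is an inverse
of `π(S)` in the corner `π(P) C₀(X) π(P)`; conversely such an inverse compresses to a
quasi-inverse. -/
theorem isFredholm_compression_iff {P : X →L[ℂ] X} (hP : IsIdempotentElem P) (S : X →L[ℂ] X) :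
    (compression P S).IsFredholm ↔ IsCornerUnit (toC0 P) (toC0 S) := by
  have hP' : ∀ x, P (P x) = P x := fun x => congr($hP x)
  have hPr : ∀ x : P.range, P x = x := by
    rintro ⟨_, x, rfl⟩
    exact hP' x
  set ι : P.range →L[ℂ] X := P.range.subtypeL
  set ρ : X →L[ℂ] P.range := P.rangeRestrict
  have hι : ∀ x, ((ι x : X)) = x := fun _ => rfl
  have hρ : ∀ x, (ρ x : X) = P x := fun _ => rfl
  have hc : ∀ (B : X →L[ℂ] X) x, (compression P B x : X) = P (B (P x)) := fun _ _ => rfl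
  rw [isFredholm_iff_exists_hasFiniteRange]
  constructor
  · rintro ⟨V, h₁, h₂⟩
    refine ⟨toC0 (ι ∘L V ∘L ρ), ?_, ?_⟩ <;> simp only [← map_mul, toC0_eq_iff]
    · have : P * (ι ∘L V ∘L ρ) * P * S * P - P =
          ι ∘L (V ∘L compression P S - ContinuousLinearMap.id ℂ P.range) ∘L ρ := by
        ext x
        have hx : compression P S (ρ x) = ρ (P (S (P x))) := by
          ext; simp [hc, hρ, hP']
        simp [hι, hρ, hx, hPr]
      rw [this]
      exact hasFiniteRange_comp_comp ι ρ h₁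
    · have : P * S * P * (ι ∘L V ∘L ρ) * P - P =
          ι ∘L (compression P S ∘L V - ContinuousLinearMap.id ℂ P.range) ∘L ρ := by
        ext x
        have hx : ρ (P x) = ρ x := by
          ext; simp [hρ, hP']
        simp [hι, hρ, hc, hx, hPr]
      rw [this]
      exact hasFiniteRange_comp_comp ι ρ h₂
  · rintro ⟨b, h₁, h₂⟩
    obtain ⟨B, rfl⟩ := Ideal.Quotient.mk_surjective b
    simp only [← map_mul, toC0_eq_iff] at h₁ h₂
    have hcomp : ∀ U V : X →L[ℂ] X,
        compression P U ∘L compression P V - ContinuousLinearMap.id ℂ P.range =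
          ρ ∘L (P * U * P * V * P - P) ∘L ι := by
      intro U V
      ext x
      simp [hι, hρ, hc, hP', hPr]
    refine ⟨compression P B, ?_, ?_⟩ <;> rw [hcomp]
    exacts [hasFiniteRange_comp_comp ρ ι h₁, hasFiniteRange_comp_comp ρ ι h₂]

/-- If `P` commutes with `S` modulo finite rank operators, then `S` is a finite rank perturbation of
the direct sum of its two compressions, so it is Fredholm iff both of them are. -/
theorem isFredholm_iff_compression {P S : X →L[ℂ] X} (hP : IsIdempotentElem P)
    (h : toC0 P * toC0 S = toC0 S * toC0 P) :
    S.IsFredholm ↔ (compression P S).IsFredholm ∧ (compression (1 - P) S).IsFredholm := by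
  rw [isFredholm_compression_iff hP, isFredholm_compression_iff hP.one_sub,
    ← isUnit_toC0_iff_isFredholm, isUnit_iff_isCornerUnit (hP.map toC0) h, map_sub, map_one]

theorem coe_compression_apply (P S : X →L[ℂ] X) (x : P.range) :
    (compression P S x : X) = P (S (P x)) := rfl

theorem isFredholm_smul_id {c : ℂ} (hc : c ≠ 0) :
    (c • ContinuousLinearMap.id ℂ X).IsFredholm :=
  (isUnit_toC0_iff_isFredholm _).1 <| IsUnit.map toC0 <|
    (isUnit_one (M := X →L[ℂ] X)).smul (Units.mk0 c hc)

/-- The operator `P T - c` has compressions `T₁ - c` and `-c`, the latter being Fredholm for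
`c ≠ 0`. -/
theorem isRiesz_compression_iff {P T : X →L[ℂ] X} (hP : IsIdempotentElem P)
    (h : toC0 P * toC0 T = toC0 T * toC0 P) :
    IsRiesz (compression P T) ↔
      ∀ c : ℂ, c ≠ 0 → (P * T - c • ContinuousLinearMap.id ℂ X).IsFredholm := by
  have hP' : ∀ x, P (P x) = P x := fun x => congr($hP x)
  have hid : ContinuousLinearMap.id ℂ X = 1 := rfl
  refine forall₂_congr fun c hc => ?_
  rw [isFredholm_iff_compression (S := P * T - c • ContinuousLinearMap.id ℂ X) hP]
  · have h₁ : compression P (P * T - c • ContinuousLinearMap.id ℂ X) =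
        compression P T - c • ContinuousLinearMap.id ℂ P.range := by
      ext ⟨_, x, rfl⟩
      simp [coe_compression_apply, hP']
    have h₂ : compression (1 - P) (P * T - c • ContinuousLinearMap.id ℂ X) =
        (-c) • ContinuousLinearMap.id ℂ (1 - P).range := by
      refine ContinuousLinearMap.ext fun ⟨_, x, hx⟩ => Subtype.ext ?_
      subst hx
      change (1 - P) ((P * T - c • ContinuousLinearMap.id ℂ X) ((1 - P) ((1 - P) x))) =
        (-c) • (1 - P) x
      simp [hP']
    rw [h₁, h₂, and_iff_left (isFredholm_smul_id (neg_ne_zero.2 hc))]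
  · have hPc : P * (c • 1) = (c • 1) * P := by simp
    rw [hid, map_sub, mul_sub, sub_mul, map_mul, mul_assoc, ← h]
    simp only [← map_mul, hPc]

/-- The operator `T + P` has compressions `T₁ + 1` and `T₂`. The former is written
`T₁ - (-1) • id`, in the shape of the definition of a Riesz operator. -/
theorem isFredholm_add_iff_compression {P T : X →L[ℂ] X} (hP : IsIdempotentElem P)
    (h : toC0 P * toC0 T = toC0 T * toC0 P) :
    (T + P).IsFredholm ↔
      (compression P T - (-1 : ℂ) • ContinuousLinearMap.id ℂ P.range).IsFredholm ∧
      (compression (1 - P) T).IsFredholm := by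
  have hP' : ∀ x, P (P x) = P x := fun x => congr($hP x)
  rw [isFredholm_iff_compression (S := T + P) hP]
  · have h₁ : compression P (T + P) =
        compression P T - (-1 : ℂ) • ContinuousLinearMap.id ℂ P.range := by
      ext ⟨_, x, rfl⟩
      simp [coe_compression_apply, hP']
    have h₂ : compression (1 - P) (T + P) = compression (1 - P) T := by
      refine ContinuousLinearMap.ext fun ⟨_, x, hx⟩ => Subtype.ext ?_
      subst hx
      change (1 - P) ((T + P) ((1 - P) ((1 - P) x))) = (1 - P) (T ((1 - P) ((1 - P) x)))
      simp [hP']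
    rw [h₁, h₂]
  · rw [map_add, mul_add, add_mul, h]

end Compression

/-! ### Compact perturbations of the identity -/

section Compact

variable {X : Type*} [NormedAddCommGroup X] [NormedSpace ℂ X]

theorem finiteDimensional_ker_one_sub {K : X →L[ℂ] X} (hK : IsCompactOperator K) :
    FiniteDimensional ℂ (1 - K : X →L[ℂ] X).ker := by
  have hfix : ∀ x ∈ (1 - K : X →L[ℂ] X).ker, K x = x := by
    intro x hx
    have : x - K x = 0 := hx
    exact (sub_eq_zero.1 this).symm
  have h := hK.restrict (f := K.toLinearMap) (V := (1 - K : X →L[ℂ] X).ker)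
    (fun x hx => by rw [ContinuousLinearMap.coe_coe, hfix x hx]; exact hx)
    (1 - K : X →L[ℂ] X).isClosed_ker
  refine FiniteDimensional.of_isCompactOperator_id (𝕜 := ℂ) ?_
  refine (funext fun x => Subtype.ext ?_ : (id : (1 - K : X →L[ℂ] X).ker → _) = _) ▸ h
  exact (hfix x x.2).symm

/-- On a closed subspace on which it is injective, `1 - K` is bounded below. -/
theorem exists_antilipschitzWith_domRestrict {K : X →L[ℂ] X} (hK : IsCompactOperator K)
    {M : Submodule ℂ X} (hM : IsClosed (M : Set X))
    (hdisj : Disjoint M (1 - K : X →L[ℂ] X).ker) :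
    ∃ c, AntilipschitzWith c ((1 - K : X →L[ℂ] X).domRestrict M) := by
  rw [antilipschitzWith_iff_exists_mul_le_norm]
  by_contra! hcon
  -- Otherwise there are unit vectors `x n ∈ M` with `(1 - K) (x n) → 0`.
  have hseq : ∀ n : ℕ, ∃ x ∈ M, ‖x‖ = 1 ∧ ‖x - K x‖ < 1 / (n + 1) := by
    intro n
    obtain ⟨x, hx⟩ := hcon (1 / (n + 1)) (by positivity)
    have hx' : ‖(x : X) - K x‖ < 1 / (n + 1) * ‖(x : X)‖ := hx
    have hx0 : 0 < ‖(x : X)‖ := by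
      by_contra! h0
      have : ‖(x : X)‖ = 0 := le_antisymm h0 (norm_nonneg _)
      rw [this, mul_zero] at hx'
      exact absurd hx' (norm_nonneg _).not_gt
    refine ⟨((‖(x : X)‖⁻¹ : ℝ) : ℂ) • (x : X), M.smul_mem _ x.2, ?_, ?_⟩
    · rw [norm_smul]; simp [hx0.ne']
    · rw [map_smul, ← smul_sub, norm_smul]
      simp only [Complex.norm_real, norm_inv, norm_norm]
      rw [inv_mul_lt_iff₀ hx0, mul_comm]
      exact hx'
  choose x hxM hx1 hx using hseq
  have hlim : Tendsto (fun n => x n - K (x n)) atTop (𝓝 0) :=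
    squeeze_zero_norm (fun n => (hx n).le) tendsto_one_div_add_atTop_nhds_zero_nat
  obtain ⟨C, hC, hC'⟩ := hK.image_closedBall_subset_compact 1
  obtain ⟨y, -, φ, hφ, hφy⟩ := hC.tendsto_subseq (x := fun n => K (x n))
    (fun n => hC' ⟨x n, by simp [hx1], rfl⟩)
  -- Along a subsequence `K (x n)`, hence also `x n`, converges to some `y`.
  have hxy : Tendsto (fun n => x (φ n)) atTop (𝓝 y) := by
    simpa using (hlim.comp hφ.tendsto_atTop).add hφy
  have hyM : y ∈ M := hM.mem_of_tendsto hxy (Eventually.of_forall fun n => hxM _)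
  have hy1 : ‖y‖ = 1 := by
    refine tendsto_nhds_unique hxy.norm ?_
    simp [hx1]
  have hyk : y ∈ (1 - K : X →L[ℂ] X).ker := by
    have h := ((K.continuous.tendsto y).comp hxy)
    have h' : K y = y := tendsto_nhds_unique h hφy
    change y - K y = 0
    rw [h', sub_self]
  have : y = 0 := Submodule.disjoint_def.1 hdisj y hyM hyk
  simp [this] at hy1

/-- If the range of `1 - K` is closed then `K` induces a compact operator on the quotient by it; as
this operator is the identity, the quotient is finite-dimensional. -/
theorem cofg_range_one_sub {K : X →L[ℂ] X} (hK : IsCompactOperator K)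
    (hcl : IsClosed ((1 - K : X →L[ℂ] X).range : Set X)) :
    (1 - K : X →L[ℂ] X).range.CoFG := by
  set R := (1 - K : X →L[ℂ] X).range
  -- `K` induces the identity on the quotient by the range of `1 - K`.
  have hq : ∀ x, R.mkQL (K x) = R.mkQL x := by
    intro x
    refine ((Submodule.Quotient.eq R).2 ?_).symm
    exact ⟨x, rfl⟩
  have : IsClosed (R : Set X) := hcl
  refine FiniteDimensional.of_isCompactOperator_id (𝕜 := ℂ) (E := X ⧸ R) ?_
  obtain ⟨C, hC, hC'⟩ := hK
  refine ⟨R.mkQL '' C, hC.image R.mkQL.continuous, ?_⟩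
  -- The open quotient map sends the neighborhood `K ⁻¹' C` of zero to a neighborhood of zero, and
  -- by `hq` the latter lies in the compact image of `C`.
  have hmem := R.isOpenQuotientMap_mkQL.isOpenMap.image_mem_nhds hC'
  rw [map_zero] at hmem
  refine Filter.mem_of_superset hmem ?_
  rintro _ ⟨x, hx, rfl⟩
  exact ⟨K x, hx, hq x⟩

variable (X) in
theorem finiteRankIdeal_le_compactIdeal : finiteRankIdeal X ≤ compactIdeal X := by
  intro F hF
  have : FiniteDimensional ℂ F.range := hF
  have : ProperSpace F.range := FiniteDimensional.proper ℂ _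
  have h : IsCompactOperator F.rangeRestrict :=
    isCompactOperator_of_locallyCompactSpace_dom F.rangeRestrict
  exact h.clm_comp F.range.subtypeL

variable [CompleteSpace X]

/-- Riesz's theorem: `1 - K` is Fredholm for every compact `K`. -/
theorem isFredholm_one_sub_of_isCompactOperator {K : X →L[ℂ] X} (hK : IsCompactOperator K) :
    (1 - K : X →L[ℂ] X).IsFredholm := by
  have hfin := finiteDimensional_ker_one_sub hK
  have hcompl := Submodule.ClosedComplemented.of_finiteDimensional (1 - K : X →L[ℂ] X).ker
  obtain ⟨M, hM⟩ := hcompl.exists_isTopCompl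
  have hMcl : IsClosed (M : Set X) := hM.symm.isClosed
  have : M.CoFG := ((Submodule.fg_iff_finiteDimensional _).2 hfin).cofg_of_isCompl hM.isCompl
  obtain ⟨c, hc⟩ := exists_antilipschitzWith_domRestrict hK hMcl hM.isCompl.disjoint.symm
  have : CompleteSpace M := hMcl.completeSpace_coe
  have hemb := hc.isClosedEmbedding ((1 - K : X →L[ℂ] X).domRestrict M).uniformContinuous
  obtain ⟨hstrict, hrange⟩ :=
    ((1 - K : X →L[ℂ] X).isStrictMap_isClosed_range_iff_restrict M hMcl).2
      ⟨hemb.isEmbedding.isStrictMap, hemb.isClosed_range⟩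
  exact ⟨hstrict, hrange, hfin, cofg_range_one_sub hK hrange, hcompl⟩

/-- Atkinson's theorem in the Calkin algebra: if `S` is invertible modulo compact operators, then
the products of `S` with its inverse have the form `1 - K` with `K` compact, and are therefore
invertible modulo finite rank operators. -/
theorem isUnit_toCalkin_iff_isFredholm (S : X →L[ℂ] X) : IsUnit (toCalkin S) ↔ S.IsFredholm := by
  constructor
  · intro h
    obtain ⟨b, h₁, h₂⟩ := isUnit_iff_exists.1 h
    obtain ⟨B, rfl⟩ := Ideal.Quotient.mk_surjective b
    have key : ∀ U V : X →L[ℂ] X, toCalkin U * toCalkin V = 1 → IsUnit (toC0 U * toC0 V) := by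
      intro U V hUV
      rw [← map_mul, ← map_one toCalkin, eq_comm, Ideal.Quotient.mk_eq_mk_iff_sub_mem] at hUV
      rw [← map_mul, isUnit_toC0_iff_isFredholm]
      simpa using isFredholm_one_sub_of_isCompactOperator hUV
    rw [← isUnit_toC0_iff_isFredholm]
    obtain ⟨u, hu⟩ := key _ _ h₁
    obtain ⟨v, hv⟩ := key _ _ h₂
    refine isUnit_iff_exists_and_exists.2 ⟨⟨toC0 B * (u⁻¹ : _ˣ), ?_⟩, ⟨(v⁻¹ : _ˣ) * toC0 B, ?_⟩⟩
    · rw [← mul_assoc, ← hu, u.mul_inv]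
    · rw [mul_assoc, ← hv, v.inv_mul]
  · intro h
    have := ((isUnit_toC0_iff_isFredholm S).2 h).map
      (Ideal.Quotient.factor (finiteRankIdeal_le_compactIdeal X))
    simpa using this

end Compact

/-! ### Quasinilpotence in Banach algebras and in the Calkin algebra -/

section Banach

/-- Nonzero scalars are central units, so `1 - c⁻¹ a` is one of the elements required to be
invertible. -/
theorem IsQuasinilpotent.isUnit_sub {A : Type*} [Ring A] [Algebra ℂ A] {a : A}
    (ha : IsQuasinilpotent a) {c : ℂ} (hc : c ≠ 0) : IsUnit (a - algebraMap ℂ A c) := by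
  have h := ha (algebraMap ℂ A c⁻¹) (Algebra.commutes c⁻¹ a)
  have hc' : IsUnit (algebraMap ℂ A (-c)) := (isUnit_iff_ne_zero.2 (neg_ne_zero.2 hc)).map _
  have := hc'.mul h
  rwa [mul_sub, ← mul_assoc, ← map_mul, neg_mul, mul_inv_cancel₀ hc, map_neg, map_neg, mul_one,
    map_one, neg_one_mul, sub_neg_eq_add, neg_add_eq_sub] at this

/-- In a complex Banach algebra, an element `a` with `a - c` invertible for all `c ≠ 0` has
spectral radius zero; for `x` commuting with `a`, some power of `x a` then has norm less than one,
whence `1 - x a` is invertible. -/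
theorem isQuasinilpotent_of_isUnit_sub {A : Type*} [NormedRing A] [NormedAlgebra ℂ A]
    [CompleteSpace A] {a : A} (ha : ∀ c : ℂ, c ≠ 0 → IsUnit (a - algebraMap ℂ A c)) :
    IsQuasinilpotent a := by
  intro x hx
  have hcomm : Commute x a := hx
  have hrad : spectralRadius ℂ a = 0 := by
    refine le_antisymm (iSup₂_le fun c hc => ?_) zero_le
    by_cases h0 : c = 0
    · simp [h0]
    · refine absurd ?_ hc
      rw [spectrum.mem_resolventSet_iff, ← IsUnit.neg_iff, neg_sub]
      exact ha c h0
  have hlim := spectrum.pow_norm_pow_one_div_tendsto_nhds_spectralRadius a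
  rw [hrad] at hlim
  have hpos : 0 < (‖x‖ + 1)⁻¹ := by positivity
  obtain ⟨n, hn, hn1⟩ := ((hlim.eventually (gt_mem_nhds (ENNReal.ofReal_pos.2 hpos))).and
    (eventually_ge_atTop 1)).exists
  -- Now `‖a ^ n‖ ^ (1 / n) < 1 / (‖x‖ + 1)`, where `n ≥ 1` makes the exponent a genuine root.
  rw [ENNReal.ofReal_lt_ofReal_iff hpos] at hn
  have hn0 : n ≠ 0 := by omega
  have hlt : ‖(x * a) ^ n‖ < 1 := by
    set t := ‖a ^ n‖ ^ (1 / n : ℝ)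
    have ht0 : 0 ≤ t := by positivity
    have ht : t ^ n = ‖a ^ n‖ := by
      simp only [t, one_div]
      exact Real.rpow_inv_natCast_pow (norm_nonneg _) hn0
    calc ‖(x * a) ^ n‖ ≤ ‖x ^ n‖ * ‖a ^ n‖ := by rw [hcomm.mul_pow]; exact norm_mul_le _ _
      _ ≤ ‖x‖ ^ n * t ^ n := by rw [ht]; gcongr; exact norm_pow_le' x hn1
      _ = (‖x‖ * t) ^ n := (mul_pow _ _ _).symm
      _ < 1 := by
        refine pow_lt_one₀ (by positivity) ?_ hn0
        rw [← one_div, lt_div_iff₀ (by positivity)] at hn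
        nlinarith
  -- `1 - x a` is a factor of the unit `1 - (x a) ^ n`.
  have hu := isUnit_one_sub_of_norm_lt_one hlt
  rw [← mul_neg_geom_sum] at hu
  refine ((Commute.isUnit_mul_iff ?_).1 hu).1
  refine Commute.sum_right _ _ _ fun i _ => ?_
  exact ((Commute.one_left _).sub_left (Commute.refl _)).pow_right i

variable {X : Type*} [NormedAddCommGroup X] [NormedSpace ℂ X] [CompleteSpace X]

instance isClosed_compactIdeal : IsClosed (compactIdeal X : Set (X →L[ℂ] X)) :=
  isClosed_setOfPred_isCompactOperator

variable (X) in
/-- The Calkin algebra with the quotient norm is a normed ring. The ring structure is the one of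
the quotient by a two-sided ideal, so that invertibility has its original meaning. -/
noncomputable instance calkinNormedRing : NormedRing (Calkin X) :=
  { Submodule.Quotient.normedAddCommGroup (compactIdeal X),
    Ideal.Quotient.ring (compactIdeal X) with
    norm_mul_le x y := by
      refine le_of_forall_pos_le_add fun ε hε => ?_
      have := ((Metric.nhds_basis_ball.prod_nhds Metric.nhds_basis_ball).tendsto_iff
        Metric.nhds_basis_ball).mp (continuous_mul.tendsto (‖x‖, ‖y‖)) ε hε
      simp only [Set.mem_prod, Metric.mem_ball, and_imp, Prod.forall, Prod.exists] at this
      rcases this with ⟨ε₁, ε₂, ⟨h₁, h₂⟩, h⟩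
      obtain ⟨⟨a, rfl, ha⟩, ⟨b, rfl, hb⟩⟩ := Submodule.Quotient.norm_mk_lt x h₁,
        Submodule.Quotient.norm_mk_lt y h₂
      simp only [dist, abs_sub_lt_iff] at h
      specialize h ‖a‖ ‖b‖
        ⟨by linarith, by linarith [Submodule.Quotient.norm_mk_le (compactIdeal X) a]⟩
        ⟨by linarith, by linarith [Submodule.Quotient.norm_mk_le (compactIdeal X) b]⟩
      calc
        _ ≤ ‖a‖ * ‖b‖ :=
          (Submodule.Quotient.norm_mk_le (compactIdeal X) (a * b)).trans (norm_mul_le a b)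
        _ ≤ _ := (sub_lt_iff_lt_add'.mp h.1).le }

variable (X) in
/-- The Calkin algebra with the quotient norm is a complex normed algebra. -/
noncomputable instance calkinNormedAlgebra : NormedAlgebra ℂ (Calkin X) :=
  { Submodule.Quotient.normedSpace (compactIdeal X) ℂ,
    Ideal.Quotient.algebra ℂ (I := compactIdeal X) with }

theorem isQuasinilpotent_toCalkin {S : X →L[ℂ] X}
    (h : ∀ c : ℂ, c ≠ 0 → (S - c • ContinuousLinearMap.id ℂ X).IsFredholm) :
    IsQuasinilpotent (toCalkin S) := by
  refine isQuasinilpotent_of_isUnit_sub fun c hc => ?_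
  exact (isUnit_toCalkin_iff_isFredholm _).2 (h c hc)

end Banach

/-! ### Association of idempotents in the two quotient algebras -/

section Association

variable {X : Type*} [NormedAddCommGroup X] [NormedSpace ℂ X]

theorem mem_commutant_toCalkin {S U : X →L[ℂ] X} (h : toC0 U ∈ commutant (toC0 S)) :
    toCalkin U ∈ commutant (toCalkin S) :=
  congr(Ideal.Quotient.factor (finiteRankIdeal_le_compactIdeal X) $h)

/-- The block diagonal part `P T P + (1 - P) T (1 - P)` of `T` leaves `R(P)` and `N(P)` invariant
and restricts to `T₁` and `T₂` on them. -/
theorem isRieszFredholm_blockDiagonal {T P : X →L[ℂ] X} (hP : IsIdempotentElem P)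
    (h₁ : IsRiesz (compression P T)) (h₂ : (compression (1 - P) T).IsFredholm) :
    IsRieszFredholm (P * T * P + (1 - P) * T * (1 - P)) := by
  have hP' : ∀ x, P (P x) = P x := fun x => congr($hP x)
  have hker : (1 - P : X →L[ℂ] X).range = P.ker := by
    ext x
    constructor
    · rintro ⟨y, rfl⟩
      change P (y - P y) = 0
      rw [map_sub, hP', sub_self]
    · intro hx
      have hx' : P x = 0 := hx
      exact ⟨x, by change x - P x = x; rw [hx', sub_zero]⟩
  have hrange : P.range = (1 - P : X →L[ℂ] X).ker := by
    ext x
    constructor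
    · rintro ⟨y, rfl⟩
      change P y - P (P y) = 0
      rw [hP', sub_self]
    · intro hx
      have hx' : x - P x = 0 := hx
      exact ⟨x, (sub_eq_zero.1 hx').symm⟩
  have hM : ∀ x ∈ P.range, (P * T * P + (1 - P) * T * (1 - P)) x = (P * T * P) x := by
    rintro _ ⟨x, rfl⟩
    simp [hP']
  have hN : ∀ x ∈ (1 - P : X →L[ℂ] X).range, (P * T * P + (1 - P) * T * (1 - P)) x =
      ((1 - P) * T * (1 - P)) x := by
    rintro _ ⟨x, rfl⟩
    simp [hP']
  refine ⟨P.range, (1 - P : X →L[ℂ] X).range, ?_, ?_, ?_, ?_, ?_, ?_, ?_⟩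
  · intro x hx
    rw [hM x hx]
    exact ⟨T (P x), rfl⟩
  · intro x hx
    rw [hN x hx]
    exact ⟨T ((1 - P) x), rfl⟩
  · rw [hrange]
    exact (1 - P : X →L[ℂ] X).isClosed_ker
  · rw [hker]
    exact P.isClosed_ker
  · rw [hker]
    refine ⟨Submodule.disjoint_def.2 ?_, codisjoint_iff.2 (eq_top_iff.2 fun x _ => ?_)⟩
    · rintro _ ⟨x, rfl⟩ hx
      have : P (P x) = 0 := hx
      rwa [hP'] at this
    · refine Submodule.mem_sup.2 ⟨P x, ⟨x, rfl⟩, x - P x, ?_, add_sub_cancel _ _⟩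
      change P (x - P x) = 0
      rw [map_sub, hP', sub_self]
  · convert h₁ using 1
    exact ContinuousLinearMap.ext fun x => Subtype.ext (hM x x.2)
  · convert h₂ using 1
    exact ContinuousLinearMap.ext fun x => Subtype.ext (hN x x.2)

theorem sub_blockDiagonal_mem_finiteRankIdeal {T P : X →L[ℂ] X} (hP : IsIdempotentElem P)
    (h : toC0 P * toC0 T = toC0 T * toC0 P) :
    T - (P * T * P + (1 - P) * T * (1 - P)) ∈ finiteRankIdeal X := by
  have hp : toC0 P * toC0 P = toC0 P := hP.map toC0
  have htpp : toC0 T * toC0 P * toC0 P = toC0 T * toC0 P := by rw [mul_assoc, hp]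
  rw [← Ideal.Quotient.mk_eq_mk_iff_sub_mem, map_add, map_mul, map_mul, map_mul, map_mul, map_sub,
    map_one]
  simp only [sub_mul, mul_sub, one_mul, mul_one, h, htpp]
  abel

variable [CompleteSpace X]

theorem isUnit_toC0_iff_isUnit_toCalkin (S : X →L[ℂ] X) :
    IsUnit (toC0 S) ↔ IsUnit (toCalkin S) := by
  rw [isUnit_toC0_iff_isFredholm, isUnit_toCalkin_iff_isFredholm]

/-- Although `F₀(X)` need not be closed, quasinilpotence of `π(S)` can be tested on scalars: an
element commuting with `π(S)` projects to one commuting with `Π(S)`, and invertibility means the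
same in both quotients. -/
theorem isQuasinilpotent_toC0_iff (S : X →L[ℂ] X) :
    IsQuasinilpotent (toC0 S) ↔
      ∀ c : ℂ, c ≠ 0 → (S - c • ContinuousLinearMap.id ℂ X).IsFredholm := by
  refine ⟨fun h c hc => (isUnit_toC0_iff_isFredholm _).1 (h.isUnit_sub hc), fun h x hx => ?_⟩
  obtain ⟨U, rfl⟩ := Ideal.Quotient.mk_surjective x
  have hU : toCalkin U ∈ commutant (toCalkin S) := mem_commutant_toCalkin hx
  have := isQuasinilpotent_toCalkin h _ hU
  rwa [← map_mul, ← map_one toCalkin, ← map_sub, ← isUnit_toC0_iff_isUnit_toCalkin, map_sub,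
    map_mul, map_one] at this

theorem isQuasinilpotent_toCalkin_iff (S : X →L[ℂ] X) :
    IsQuasinilpotent (toCalkin S) ↔
      ∀ c : ℂ, c ≠ 0 → (S - c • ContinuousLinearMap.id ℂ X).IsFredholm :=
  ⟨fun h _ hc => (isUnit_toCalkin_iff_isFredholm _).1 (h.isUnit_sub hc), isQuasinilpotent_toCalkin⟩

theorem isAssociatedC0_iff {T P : X →L[ℂ] X} :
    IsAssociatedC0 T P ↔ IsIdempotentElem P ∧ toC0 P ∈ doubleCommutant (toC0 T) ∧
      IsRiesz (compression P T) ∧ (compression (1 - P) T).IsFredholm := by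
  refine and_congr_right fun hP => and_congr_right fun hPT => ?_
  have hcomm : toC0 P * toC0 T = toC0 T * toC0 P := hPT _ rfl
  rw [← map_mul, ← map_add, isQuasinilpotent_toC0_iff, isUnit_toC0_iff_isFredholm,
    ← isRiesz_compression_iff hP hcomm]
  exact and_congr_right fun h => by
    rw [isFredholm_add_iff_compression hP hcomm, and_iff_right (h (-1) (by norm_num))]

theorem isAssociatedC0_iff_isAssociatedCalkin {T P : X →L[ℂ] X} :
    IsAssociatedC0 T P ↔ IsAssociatedCalkin T P ∧ toC0 P ∈ doubleCommutant (toC0 T) := by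
  unfold IsAssociatedC0 IsAssociatedCalkin
  rw [← map_mul, ← map_mul, ← map_add, ← map_add, isQuasinilpotent_toC0_iff,
    isQuasinilpotent_toCalkin_iff, isUnit_toC0_iff_isUnit_toCalkin]
  constructor
  · rintro ⟨hP, hPT, h₁, h₂⟩
    exact ⟨⟨hP, mem_commutant_toCalkin (hPT _ rfl), h₁, h₂⟩, hPT⟩
  · rintro ⟨⟨hP, -, h₁, h₂⟩, hPT⟩
    exact ⟨hP, hPT, h₁, h₂⟩

end Association

end BFredholm

theorem theorem3p8 {X : Type*} [NormedAddCommGroup X] [NormedSpace ℂ X] [CompleteSpace X]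
    (T : X →L[ℂ] X) :
    List.TFAE [
      BFredholm.IsGDrazinInvertibleC0 T,
      BFredholm.IsPseudoBFredholm T ∧ ∃ P : X →L[ℂ] X, BFredholm.IsAssociatedCalkin T P ∧
        BFredholm.toC0 P ∈ BFredholm.doubleCommutant (BFredholm.toC0 T),
      ∃ P : X →L[ℂ] X, IsIdempotentElem P ∧
        BFredholm.toC0 P ∈ BFredholm.doubleCommutant (BFredholm.toC0 T) ∧
        BFredholm.IsRiesz (BFredholm.compression P T) ∧
        (BFredholm.compression (1 - P) T).IsFredholm] ∧
    (BFredholm.IsGDrazinInvertibleC0 T →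
      ∃ R F : X →L[ℂ] X, BFredholm.IsRieszFredholm R ∧ F ∈ BFredholm.finiteRankIdeal X ∧
        T = R + F) := by
  have h13 : BFredholm.IsGDrazinInvertibleC0 T ↔ ∃ P : X →L[ℂ] X, IsIdempotentElem P ∧
      BFredholm.toC0 P ∈ BFredholm.doubleCommutant (BFredholm.toC0 T) ∧
        BFredholm.IsRiesz (BFredholm.compression P T) ∧
          (BFredholm.compression (1 - P) T).IsFredholm :=
    exists_congr fun _ => BFredholm.isAssociatedC0_iff
  have h12 : BFredholm.IsGDrazinInvertibleC0 T ↔ ∃ P : X →L[ℂ] X,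
      BFredholm.IsAssociatedCalkin T P ∧
        BFredholm.toC0 P ∈ BFredholm.doubleCommutant (BFredholm.toC0 T) :=
    exists_congr fun _ => BFredholm.isAssociatedC0_iff_isAssociatedCalkin
  refine ⟨?_, fun h => ?_⟩
  · tfae_have 1 ↔ 3 := h13
    tfae_have 1 → 2 := fun h => by
      obtain ⟨P, hP, hPT⟩ := h12.1 h
      exact ⟨⟨P, hP⟩, P, hP, hPT⟩
    tfae_have 2 → 1 := fun h => h12.2 h.2
    tfae_finish
  · obtain ⟨P, hP, hPT, h₁, h₂⟩ := h13.1 h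
    exact ⟨_, _, BFredholm.isRieszFredholm_blockDiagonal hP h₁ h₂,
      BFredholm.sub_blockDiagonal_mem_finiteRankIdeal hP (hPT _ rfl), (add_sub_cancel _ _).symm⟩
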